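/- Let $\mathcal T$ be a triangulated category (the octahedral axiom included). By a heart on $\mathcal T$ we mean the heart $\mathcal A=\mathcal T^{\le 0}\cap\mathcal T^{\ge 0}$ of a bounded t-structure on $\mathcal T$, where bounded means that every object lies in $\mathcal T^{\le b}\cap\mathcal T^{\ge a}$ for some integers $a,b$; it is a full subcategory of $\mathcal T$ and an abelian category, and every short exact sequence $0\to X_1\to X_2\to X_3\to 0$ in $\mathcal A$ extends in a unique way to a distinguished triangle $X_1\to X_2\to X_3\to X_1[1]$, whose last morphism is called the connecting morphism of the sequence. A realization functor for $\mathcal A$ is an exact functor $\mathsf{real}\colon \mathrm D^{\mathrm b}(\mathcal A)\to\mathcal T$ whose restriction to $\mathcal A$ (embedded in $\mathrm D^{\mathrm b}(\mathcal A)$ as complexes in degree $0$) is isomorphic to the inclusion $\mathcal A\subset\mathcal T$. The category $\mathcal T$ is called realized if for every full triangulated subcategory $\mathcal S\subset\mathcal T$ and every heart $\mathcal B$ on $\mathcal S$ there exists a realization functor $\mathrm D^{\mathrm b}(\mathcal B)\to\mathcal S$. For $A,B\in\mathcal A$ and $n\in\mathbb N$ let $f_{n,A,B}\colon \mathrm{Ext}^n_{\mathcal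 A}(A,B)\to\mathrm{Hom}_{\mathcal T}(A,B[n])$ be the following well-defined group homomorphism: $f_{0,A,B}$ is the inclusion $\mathrm{Hom}_{\mathcal A}(A,B)=\mathrm{Hom}_{\mathcal T}(A,B)$; for $n\ge 1$, the class of an $n$-extension $0\to B\to X_1\to\dots\to X_n\to A\to 0$, split into short exact sequences $0\to C_{i-1}\to X_i\to C_i\to 0$ for $i=1,\dots,n$ (with $C_0=B$ and $C_n=A$), is sent to the composite $A\to C_{n-1}[1]\to\dots\to C_1[n-1]\to B[n]$ of the (shifted) connecting morphisms. We say that $\mathcal T$ has all the Ext groups of $\mathcal A$ if $f_{n,A,B}$ is an isomorphism for all $A,B\in\mathcal A$ and all $n\in\mathbb N$. **Proposition.** Let $\mathcal T$ be a realized triangulated category and let $\mathcal A$ be a heart on $\mathcal T$. Then a realization functor $\mathrm D^{\mathrm b}(\mathcal A)\to\mathcal T$ exists, and for every realization functor $\mathsf{real}\colon\mathrm D^{\mathrm b}(\mathcal A)\to\mathcal T$ the following are equivalent: 1. $\mathcal T$ has all the Ext groups of $\mathcal A$; 2. $\mathsf{real}$ is fully faithful; 3. $\mathsf{real}$ is full.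 Moreover, if these conditions hold, then $\mathsf{real}$ is an exact equivalence. -/

import Mathlib

open CategoryTheory CategoryTheory.Limits CategoryTheory.Pretriangulated
  CategoryTheory.Triangulated CategoryTheory.Abelian

universe v u

namespace HeartRealization

section Eff
universe w
variable {C : Type u} [Category.{v} C] [Abelian C] [HasExt.{w} C]

/-- Every class in `Extⁿ⁺¹(A, B)` is killed by pulling back along some epimorphism `P ⟶ A`. -/
lemma exists_epi_comp_eq_zero {A B : C} {n : ℕ} (x : Ext A B (n + 1)) :
    ∃ (P : C) (p : P ⟶ A), Epi p ∧ (Ext.mk₀ p).comp x (zero_add (n + 1)) = 0 := by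
  let := HasDerivedCategory.standard C
  let e := ((DerivedCategory.singleFunctors C).shiftIso ((n + 1 : ℕ) : ℤ) (-((n + 1 : ℕ) : ℤ)) 0
    (by lia)).app B
  let f : DerivedCategory.Q.obj ((CochainComplex.singleFunctor C 0).obj A) ⟶
      DerivedCategory.Q.obj ((CochainComplex.singleFunctor C (-((n + 1 : ℕ) : ℤ))).obj B) :=
    x.hom ≫ e.hom
  obtain ⟨X', hX', s, hs, g, fac⟩ := DerivedCategory.right_fac_of_isStrictlyLE f 0
  let Y := (CochainComplex.singleFunctor C 0).obj A
  have hd : X'.d 0 1 = 0 := (X'.isZero_of_isStrictlyLE 0 1 (by lia)).eq_of_tgt _ _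
  have hY : IsZero (Y.X (-1)) := HomologicalComplex.isZero_single_obj_X _ _ _ _ (by lia)
  have hY' : IsZero (Y.X 1) := HomologicalComplex.isZero_single_obj_X _ _ _ _ (by lia)
  have i1 : IsIso (Y.homologyπ 0) := Y.isIso_homologyπ (-1) 0 (by simp) (hY.eq_of_src _ _)
  have i2 : IsIso (Y.iCycles 0) := Y.isIso_iCycles 0 1 (by simp) (hY'.eq_of_tgt _ _)
  have qs : QuasiIso s := by rwa [← DerivedCategory.isIso_Q_map_iff_quasiIso]
  have hep : Epi (s.f 0) := by
    have h1 : Epi (HomologicalComplex.cyclesMap s 0 ≫ Y.homologyπ 0) := by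
      rw [← HomologicalComplex.homologyπ_naturality]
      infer_instance
    have h2 : Epi (HomologicalComplex.cyclesMap s 0) := by
      have := epi_comp (HomologicalComplex.cyclesMap s 0 ≫ Y.homologyπ 0) (inv (Y.homologyπ 0))
      simpa using this
    have h3 : Epi (X'.iCycles 0 ≫ s.f 0) := by
      rw [← HomologicalComplex.cyclesMap_i]
      infer_instance
    exact epi_of_epi (X'.iCycles 0) (s.f 0)
  let eA : Y.X 0 ≅ A := HomologicalComplex.singleObjXSelf (ComplexShape.up ℤ) 0 A
  let j : (CochainComplex.singleFunctor C 0).obj (X'.X 0) ⟶ X' :=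
    HomologicalComplex.mkHomFromSingle (𝟙 _) (by
      intro k hk
      obtain rfl : k = 1 := by simpa using hk.symm
      simp [hd])
  refine ⟨X'.X 0, s.f 0 ≫ eA.hom, inferInstance, ?_⟩
  have hjs : j ≫ s = (CochainComplex.singleFunctor C 0).map (s.f 0 ≫ eA.hom) := by
    apply HomologicalComplex.from_single_hom_ext
    have e1 := HomologicalComplex.single_map_f_self (ComplexShape.up ℤ) 0 (s.f 0 ≫ eA.hom)
    have e2 : j.f 0 = (HomologicalComplex.singleObjXSelf (ComplexShape.up ℤ) 0 (X'.X 0)).hom ≫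
        𝟙 _ := HomologicalComplex.mkHomFromSingle_f _ _
    have e3 : (s.f 0 ≫ eA.hom) ≫ eA.inv = s.f 0 := by simp
    refine Eq.trans ?_ e1.symm
    rw [HomologicalComplex.comp_f, e2, Category.comp_id]
    exact congrArg (fun z => _ ≫ z) e3.symm
  have hjg : j ≫ g = 0 := by
    ext i
    by_cases hi : i = 0
    · subst hi
      exact (HomologicalComplex.isZero_single_obj_X _ _ _ _ (by lia)).eq_of_tgt _ _
    · exact (HomologicalComplex.isZero_single_obj_X _ _ _ _ hi).eq_of_src _ _
  ext
  have key : (DerivedCategory.singleFunctor C 0).map (s.f 0 ≫ eA.hom) ≫ x.hom ≫ e.hom = 0 := by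
    change DerivedCategory.Q.map ((CochainComplex.singleFunctor C 0).map (s.f 0 ≫ eA.hom)) ≫ f = 0
    rw [fac, ← hjs, Functor.map_comp, Category.assoc, IsIso.hom_inv_id_assoc, ← Functor.map_comp,
      hjg, Functor.map_zero]
  rw [Ext.comp_hom, Ext.mk₀_hom, ShiftedHom.mk₀_comp, Ext.zero_hom, ← cancel_mono e.hom,
    Category.assoc]
  exact key.trans zero_comp.symm

end Eff

section Heart

variable {T : Type u} [Category.{v} T] [Preadditive T] [HasZeroObject T] [HasShift T ℤ]
  [∀ n : ℤ, (shiftFunctor T n).Additive] [Pretriangulated T] (t : TStructure T)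

/-- A t-structure is bounded if every object `X` lies in `T^{≤ b} ∩ T^{≥ a}` for some integers
`a` and `b`. -/
def IsBounded : Prop := ∀ X : T, t.bounded X

instance isLE_heart (A : t.heart.FullSubcategory) : t.IsLE A.obj 0 := ⟨A.property.1⟩

instance isGE_heart (A : t.heart.FullSubcategory) : t.IsGE A.obj 0 := ⟨A.property.2⟩

instance containsZero_heart : t.heart.ContainsZero where
  exists_zero := ⟨_, isZero_zero T, (t.mem_heart_iff _).2
    ⟨t.isLE_of_isZero (isZero_zero T) 0, t.isGE_of_isZero (isZero_zero T) 0⟩⟩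

instance binaryProducts_heart : t.heart.IsClosedUnderBinaryProducts where
  limitsOfShape_le := by
    rintro X ⟨p⟩
    have h₁ := (t.mem_heart_iff _).1 (p.prop_diag_obj (.mk .left))
    have h₂ := (t.mem_heart_iff _).1 (p.prop_diag_obj (.mk .right))
    refine t.heart.prop_of_iso ?_ ((t.mem_heart_iff _).2
      ⟨t.isLE₂ _ (binaryProductTriangle_distinguished (p.diag.obj (.mk .left))
          (p.diag.obj (.mk .right))) 0 h₁.1 h₂.1,
        t.isGE₂ _ (binaryProductTriangle_distinguished (p.diag.obj (.mk .left))
          (p.diag.obj (.mk .right))) 0 h₁.2 h₂.2⟩)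
    exact IsLimit.conePointUniqueUpToIso (prodIsProd _ _)
      ((IsLimit.postcomposeHomEquiv (diagramIsoPair p.diag) _).2 p.isLimit)

instance finiteProducts_heart : t.heart.IsClosedUnderFiniteProducts := .mk'

lemma hom_shift_eq_zero ⦃X Y : t.heart.FullSubcategory⦄ ⦃n : ℤ⦄
    (f : t.heart.ι.obj X ⟶ (t.heart.ι.obj Y)⟦n⟧) (hn : n < 0) : f = 0 := by
  have : t.IsLE (t.heart.ι.obj X) 0 := isLE_heart t X
  have : t.IsGE (t.heart.ι.obj Y) 0 := isGE_heart t Y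
  have : t.IsGE ((t.heart.ι.obj Y)⟦n⟧) (-n) := t.isGE_shift _ 0 n (-n)
  exact t.zero f 0 (-n)

lemma admissible_heart [IsTriangulated T] :
    AbelianSubcategory.admissibleMorphism t.heart.ι = ⊤ := by
  ext X₁ X₂ f₁
  simp only [MorphismProperty.top_apply, iff_true]
  intro X₃ f₂ f₃ hT
  have : t.IsLE (t.heart.ι.obj X₁) 0 := isLE_heart t X₁
  have : t.IsGE (t.heart.ι.obj X₁) 0 := isGE_heart t X₁
  have hX₂ : t.IsLE (t.heart.ι.obj X₂) 0 := isLE_heart t X₂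
  have hX₂' : t.IsGE (t.heart.ι.obj X₂) 0 := isGE_heart t X₂
  have h₁ : t.IsLE ((t.heart.ι.obj X₁)⟦(1 : ℤ)⟧) (-1) := t.isLE_shift _ 0 1 (-1)
  have h₂ : t.IsGE ((t.heart.ι.obj X₁)⟦(1 : ℤ)⟧) (-1) := t.isGE_shift _ 0 1 (-1)
  have h₁' : t.IsLE ((t.heart.ι.obj X₁)⟦(1 : ℤ)⟧) 0 := t.isLE_of_le _ (-1) 0
  have hX₂'' : t.IsGE (t.heart.ι.obj X₂) (-1) := t.isGE_of_ge _ (-1) 0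
  have : t.IsLE X₃ 0 := t.isLE₂ _ (rot_of_distTriang _ hT) 0 hX₂ h₁'
  have : t.IsGE X₃ (-1) := t.isGE₂ _ (rot_of_distTriang _ hT) (-1) hX₂'' h₂
  let L := (t.truncLE (-1)).obj X₃
  have hL₁ : t.IsLE (L⟦(-1 : ℤ)⟧) 0 := t.isLE_shift L (-1) (-1) 0
  have hL₂ : t.IsGE (L⟦(-1 : ℤ)⟧) 0 := t.isGE_shift L (-1) (-1) 0
  let Q := (t.truncGE 0).obj X₃
  let K : t.heart.FullSubcategory := ⟨L⟦(-1 : ℤ)⟧, (t.mem_heart_iff _).2 ⟨hL₁, hL₂⟩⟩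
  let Q' : t.heart.FullSubcategory := ⟨Q, (t.mem_heart_iff _).2 ⟨inferInstance, inferInstance⟩⟩
  let e : (t.heart.ι.obj K)⟦(1 : ℤ)⟧ ≅ L :=
    (shiftFunctorCompIsoId T (-1 : ℤ) 1 (by lia)).app L
  let α : (t.heart.ι.obj K)⟦(1 : ℤ)⟧ ⟶ X₃ := e.hom ≫ (t.truncLEι (-1)).app X₃
  let β : X₃ ⟶ t.heart.ι.obj Q' := (t.truncGEπ 0).app X₃
  let δ : Q ⟶ L⟦(1 : ℤ)⟧ := (t.truncGEδLE (-1) 0 (by lia)).app X₃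
  have hd : Triangle.mk ((t.truncLEι (-1)).app X₃) β δ ∈ distTriang T :=
    t.triangleLEGE_distinguished (-1) 0 (by lia) X₃
  have h : (δ ≫ e.inv⟦(1 : ℤ)⟧') ≫ e.hom⟦(1 : ℤ)⟧' = 𝟙 Q ≫ δ := by
    rw [Category.assoc, ← Functor.map_comp, e.inv_hom_id, CategoryTheory.Functor.map_id, Category.comp_id,
      Category.id_comp]
  exact ⟨K, Q', α, β, δ ≫ e.inv⟦(1 : ℤ)⟧', isomorphic_distinguished _ hd _
    (Triangle.isoMk _ _ e (Iso.refl _) (Iso.refl _) (Category.comp_id α)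
      ((Category.comp_id β).trans (Category.id_comp β).symm) h)⟩

variable {t} in
lemma connecting_naturality {S S' : ShortComplex t.heart.FullSubcategory} [Epi S.g]
    (φ : S ⟶ S')
    {d : t.heart.ι.obj S.X₃ ⟶ (t.heart.ι.obj S.X₁)⟦(1 : ℤ)⟧}
    {d' : t.heart.ι.obj S'.X₃ ⟶ (t.heart.ι.obj S'.X₁)⟦(1 : ℤ)⟧}
    (hd : Triangle.mk (t.heart.ι.map S.f) (t.heart.ι.map S.g) d ∈ distTriang T)
    (hd' : Triangle.mk (t.heart.ι.map S'.f) (t.heart.ι.map S'.g) d' ∈ distTriang T) :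
    d ≫ (t.heart.ι.map φ.τ₁)⟦(1 : ℤ)⟧' = t.heart.ι.map φ.τ₃ ≫ d' := by
  obtain ⟨c, hc₁, hc₂⟩ := complete_distinguished_triangle_morphism _ _ hd hd'
    (t.heart.ι.map φ.τ₁) (t.heart.ι.map φ.τ₂)
    (show t.heart.ι.map S.f ≫ t.heart.ι.map φ.τ₂ = t.heart.ι.map φ.τ₁ ≫ t.heart.ι.map S'.f by
      rw [← Functor.map_comp, ← Functor.map_comp, φ.comm₁₂])
  obtain ⟨c', rfl⟩ := t.heart.ι.map_surjective
    (show t.heart.ι.obj S.X₃ ⟶ t.heart.ι.obj S'.X₃ from c)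
  have hc₁' : t.heart.ι.map S.g ≫ t.heart.ι.map c' =
      t.heart.ι.map φ.τ₂ ≫ t.heart.ι.map S'.g := hc₁
  obtain rfl : c' = φ.τ₃ := by
    rw [← cancel_epi S.g, ← φ.comm₂₃]
    apply t.heart.ι.map_injective
    rw [Functor.map_comp, Functor.map_comp, hc₁']
  exact hc₂

/-- The heart of a t-structure is an abelian category. -/
noncomputable instance abelianHeart [IsTriangulated T] : Abelian t.heart.FullSubcategory :=
  AbelianSubcategory.abelian t.heart.ι (hom_shift_eq_zero t) (admissible_heart t)

variable [IsTriangulated T]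

noncomputable instance hasDerivedCategoryHeart :
    HasDerivedCategory.{max u v} t.heart.FullSubcategory :=
  HasDerivedCategory.standard _

instance hasExtHeart : HasExt.{max u v} t.heart.FullSubcategory := HasExt.standard _

variable {t}

/-- A short exact sequence `0 → X₁ → X₂ → X₃ → 0` in the heart extends uniquely to a
distinguished triangle `X₁ → X₂ → X₃ → X₁[1]`. -/
lemma existsUnique_connecting {S : ShortComplex t.heart.FullSubcategory} (hS : S.ShortExact) :
    ∃! d : t.heart.ι.obj S.X₃ ⟶ (t.heart.ι.obj S.X₁)⟦(1 : ℤ)⟧,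
      Triangle.mk (t.heart.ι.map S.f) (t.heart.ι.map S.g) d ∈ distTriang T := by
  refine existsUnique_of_exists_of_unique ?_ ?_
  · have := hS.epi_g
    obtain ⟨K, i, d, hT⟩ := AbelianSubcategory.exists_distinguished_triangle_of_epi
      (hom_shift_eq_zero t) (admissible_heart t) S.g
    let lim := AbelianSubcategory.isLimitKernelForkOfDistTriang (hom_shift_eq_zero t) i S.g d hT
    let e : S.X₁ ≅ K := IsLimit.conePointUniqueUpToIso hS.fIsKernel lim
    have he : e.hom ≫ i = S.f :=
      IsLimit.conePointUniqueUpToIso_hom_comp hS.fIsKernel lim WalkingParallelPair.zero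
    let E := t.heart.ι.mapIso e
    have h1 : t.heart.ι.map S.f ≫ 𝟙 _ = E.hom ≫ t.heart.ι.map i := by
      rw [Category.comp_id, ← he, Functor.map_comp]; rfl
    have h3 : (d ≫ E.inv⟦(1 : ℤ)⟧') ≫ E.hom⟦(1 : ℤ)⟧' = 𝟙 _ ≫ d := by
      rw [Category.assoc, ← Functor.map_comp, E.inv_hom_id, CategoryTheory.Functor.map_id,
        Category.comp_id, Category.id_comp]
    exact ⟨d ≫ E.inv⟦(1 : ℤ)⟧', isomorphic_distinguished _ hT _
      (Triangle.isoMk _ _ E (Iso.refl _) (Iso.refl _) h1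
        ((Category.comp_id _).trans (Category.id_comp _).symm) h3)⟩
  · intro d d' hd hd'
    have := hS.epi_g
    have h := connecting_naturality (𝟙 S) hd hd'
    rw [ShortComplex.id_τ₁, ShortComplex.id_τ₃, CategoryTheory.Functor.map_id,
      CategoryTheory.Functor.map_id, CategoryTheory.Functor.map_id] at h
    exact (Category.comp_id d).symm.trans (h.trans (Category.id_comp d'))

/-- The connecting morphism `X₃ → X₁[1]` in `T` of a short exact sequence
`0 → X₁ → X₂ → X₃ → 0` in the heart. -/
noncomputable def connecting {S : ShortComplex t.heart.FullSubcategory} (hS : S.ShortExact) :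
    ShiftedHom (t.heart.ι.obj S.X₃) (t.heart.ι.obj S.X₁) (1 : ℤ) :=
  (existsUnique_connecting hS).choose

lemma connecting_distinguished {S : ShortComplex t.heart.FullSubcategory} (hS : S.ShortExact) :
    Triangle.mk (t.heart.ι.map S.f) (t.heart.ι.map S.g) (connecting hS) ∈ distTriang T :=
  (existsUnique_connecting hS).choose_spec.1

/-- `IsComposite n x α` says that the class `x` of `Extⁿ(A, B)` is the Yoneda product of the
classes of short exact sequences `0 → Cᵢ₋₁ → Xᵢ → Cᵢ → 0` (with `C₀ = B` and `Cₙ = A`), i.e. the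
class of an `n`-extension `0 → B → X₁ → ⋯ → Xₙ → A → 0`, and that `α` is the composite
`A → Cₙ₋₁[1] → ⋯ → C₁[n-1] → B[n]` of the connecting morphisms of these sequences in `T`.
For `n = 0`, it says that `x` and `α` come from the same morphism of the heart. -/
def IsComposite : ∀ (n : ℕ) {A B : t.heart.FullSubcategory}, Ext.{max u v} A B n →
    ShiftedHom (t.heart.ι.obj A) (t.heart.ι.obj B) (n : ℤ) → Prop
  | 0, A, B, x, α => ∃ g : A ⟶ B, x = Ext.mk₀ g ∧
      α = ShiftedHom.mk₀ ((0 : ℕ) : ℤ) (by simp) (t.heart.ι.map g)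
  | n + 1, A, B, x, α => ∃ (K X : t.heart.FullSubcategory) (i : K ⟶ X) (p : X ⟶ A) (w : i ≫ p = 0)
      (hS : (ShortComplex.mk i p w).ShortExact) (y : Ext.{max u v} K B n)
      (β : ShiftedHom (t.heart.ι.obj K) (t.heart.ι.obj B) (n : ℤ)),
      IsComposite n y β ∧ x = hS.extClass.comp y (add_comm 1 n) ∧
        α = (connecting hS).comp β (by push_cast; ring)

section Comparison

/-- An additive family of maps `Extⁿ(A, B) → Hom(A, B[n])`, natural in `A`, whose graph
is the relation `IsComposite n`. -/
structure GraphMap (t : TStructure T) (n : ℕ) where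
  map : ∀ A B : t.heart.FullSubcategory, Ext.{max u v} A B n →+
    ShiftedHom (t.heart.ι.obj A) (t.heart.ι.obj B) (n : ℤ)
  map_precomp : ∀ {A' A B : t.heart.FullSubcategory} (g : A' ⟶ A) (x : Ext.{max u v} A B n),
    map A' B ((Ext.mk₀ g).comp x (zero_add n)) = t.heart.ι.map g ≫ map A B x
  graph : ∀ {A B : t.heart.FullSubcategory} (x : Ext.{max u v} A B n)
    (α : ShiftedHom (t.heart.ι.obj A) (t.heart.ι.obj B) (n : ℤ)),
    IsComposite n x α ↔ α = map A B x

lemma GraphMap.nonempty_zero : Nonempty (GraphMap t 0) := by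
  let f (A B : t.heart.FullSubcategory) : Ext.{max u v} A B 0 →+
      ShiftedHom (t.heart.ι.obj A) (t.heart.ι.obj B) ((0 : ℕ) : ℤ) :=
    AddMonoidHom.mk' (fun x => ShiftedHom.mk₀ ((0 : ℕ) : ℤ) (by simp)
      (t.heart.ι.map (Ext.addEquiv₀ x))) (fun x y => by
        rw [map_add, Functor.map_add, ShiftedHom.mk₀_add])
  have hf {A B : t.heart.FullSubcategory} (g : A ⟶ B) : f A B (Ext.mk₀ g) =
      ShiftedHom.mk₀ ((0 : ℕ) : ℤ) (by simp) (t.heart.ι.map g) := by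
    have : Ext.addEquiv₀ (Ext.mk₀ g) = g := Ext.addEquiv₀.apply_symm_apply g
    simp only [f, AddMonoidHom.mk'_apply, this]
  have hs {A B : t.heart.FullSubcategory} (x : Ext.{max u v} A B 0) :
      ∃ g, x = Ext.mk₀ g := ⟨Ext.addEquiv₀ x, (Ext.addEquiv₀.symm_apply_apply x).symm⟩
  refine ⟨⟨f, ?_, ?_⟩⟩
  · intro A' A B g x
    obtain ⟨h, rfl⟩ := hs x
    rw [Ext.mk₀_comp_mk₀, hf, hf, Functor.map_comp]
    simp [ShiftedHom.mk₀]
  · intro A B x α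
    constructor
    · rintro ⟨g, rfl, rfl⟩
      rw [hf]
    · rintro rfl
      obtain ⟨g, rfl⟩ := hs x
      exact ⟨g, rfl, hf g⟩

variable {n : ℕ} (F : GraphMap t n)

/-- `x` and `α` are represented by a class `y` and the short exact sequence `S`. -/
def GraphMap.Rep {S : ShortComplex t.heart.FullSubcategory} (hS : S.ShortExact)
    {B : t.heart.FullSubcategory} (x : Ext.{max u v} S.X₃ B (n + 1))
    (α : ShiftedHom (t.heart.ι.obj S.X₃) (t.heart.ι.obj B) ((n + 1 : ℕ) : ℤ)) : Prop :=
  ∃ y : Ext.{max u v} S.X₁ B n, x = hS.extClass.comp y (add_comm 1 n) ∧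
    α = (connecting hS).comp (F.map _ _ y) (by push_cast; ring)

lemma GraphMap.Rep.precomp {S S' : ShortComplex t.heart.FullSubcategory} {hS : S.ShortExact}
    (hS' : S'.ShortExact) (φ : S' ⟶ S)
    {B : t.heart.FullSubcategory} {x : Ext.{max u v} S.X₃ B (n + 1)}
    {α : ShiftedHom (t.heart.ι.obj S.X₃) (t.heart.ι.obj B) ((n + 1 : ℕ) : ℤ)}
    (h : F.Rep hS x α) :
    F.Rep hS' ((Ext.mk₀ φ.τ₃).comp x (zero_add (n + 1))) (t.heart.ι.map φ.τ₃ ≫ α) := by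
  obtain ⟨y, rfl, rfl⟩ := h
  refine ⟨(Ext.mk₀ φ.τ₁).comp y (zero_add n), ?_, ?_⟩
  · rw [← Ext.comp_assoc (a₁₂ := 1) _ _ _ (add_zero 1) _ (by lia),
      ShortComplex.ShortExact.extClass_naturality hS' hS φ,
      Ext.comp_assoc (a₂₃ := n + 1) _ _ _ _ _ (by lia)]
  · have := hS'.epi_g
    have h := connecting_naturality φ (connecting_distinguished hS')
      (connecting_distinguished hS)
    rw [F.map_precomp]
    simp only [ShiftedHom.comp, Functor.map_comp, Category.assoc]
    exact ((Category.assoc _ _ _).symm.trans (congrArg (fun z => z ≫ _) h)).trans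
      (Category.assoc _ _ _) |>.symm

lemma GraphMap.Rep.eq_zero {S : ShortComplex t.heart.FullSubcategory} {hS : S.ShortExact}
    {B : t.heart.FullSubcategory}
    {α : ShiftedHom (t.heart.ι.obj S.X₃) (t.heart.ι.obj B) ((n + 1 : ℕ) : ℤ)}
    (h : F.Rep hS 0 α) : α = 0 := by
  obtain ⟨y, hy, rfl⟩ := h
  obtain ⟨z, rfl⟩ := Ext.contravariant_sequence_exact₁ hS B y (add_comm 1 n) hy.symm
  have h : connecting hS ≫ (t.heart.ι.map S.f)⟦(1 : ℤ)⟧' = 0 :=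
    comp_distTriang_mor_zero₃₁ _ (connecting_distinguished hS)
  rw [F.map_precomp, ShiftedHom.comp, Functor.map_comp, Category.assoc]
  exact (Category.assoc _ _ _).symm.trans ((congrArg (fun z => z ≫ _) h).trans zero_comp)

lemma GraphMap.exists_rep_of_epi {P A B : t.heart.FullSubcategory} (p : P ⟶ A) [Epi p]
    (x : Ext.{max u v} A B (n + 1)) (hx : (Ext.mk₀ p).comp x (zero_add (n + 1)) = 0)
    (hS : (ShortComplex.mk (kernel.ι p) p (kernel.condition p)).ShortExact) :
    ∃ α, F.Rep hS x α := by
  obtain ⟨y, hy⟩ := Ext.contravariant_sequence_exact₃ hS B x hx (add_comm 1 n)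
  exact ⟨_, y, hy.symm, rfl⟩

lemma shortExact_kernel {P A : t.heart.FullSubcategory} (p : P ⟶ A) [Epi p] :
    (ShortComplex.mk (kernel.ι p) p (kernel.condition p)).ShortExact where
  exact := ShortComplex.exact_of_f_is_kernel _ (kernelIsKernel p)

lemma GraphMap.Rep.of_epi {K X A B : t.heart.FullSubcategory} {i : K ⟶ X} {p : X ⟶ A}
    {w : i ≫ p = 0} {hS : (ShortComplex.mk i p w).ShortExact}
    {x : Ext.{max u v} A B (n + 1)}
    {α : ShiftedHom (t.heart.ι.obj A) (t.heart.ι.obj B) ((n + 1 : ℕ) : ℤ)}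
    (h : F.Rep hS x α) {A' P : t.heart.FullSubcategory} (g : A' ⟶ A) (q : P ⟶ A') [Epi q]
    (r : P ⟶ X) (hr : r ≫ p = q ≫ g) :
    F.Rep (shortExact_kernel q) ((Ext.mk₀ g).comp x (zero_add (n + 1)))
      (t.heart.ι.map g ≫ α) := by
  have := hS.mono_f
  let l : kernel q ⟶ K := hS.exact.lift (kernel.ι q ≫ r) (by
    simp [hr])
  have hl : l ≫ i = kernel.ι q ≫ r := hS.exact.lift_f _ _
  let φ : ShortComplex.mk (kernel.ι q) q (kernel.condition q) ⟶ ShortComplex.mk i p w :=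
    ShortComplex.Hom.mk l r g hl hr
  exact GraphMap.Rep.precomp F (hS := hS) (shortExact_kernel q) φ h

/-- The relation on `Extⁿ⁺¹(A, B) × Hom(A, B[n+1])` induced by `F`. -/
def GraphMap.Succ {A B : t.heart.FullSubcategory} (x : Ext.{max u v} A B (n + 1))
    (α : ShiftedHom (t.heart.ι.obj A) (t.heart.ι.obj B) ((n + 1 : ℕ) : ℤ)) : Prop :=
  ∃ (P : t.heart.FullSubcategory) (p : P ⟶ A) (_ : Epi p), F.Rep (shortExact_kernel p) x α

lemma GraphMap.Rep.succ {K X A B : t.heart.FullSubcategory} {i : K ⟶ X} {p : X ⟶ A}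
    {w : i ≫ p = 0} {hS : (ShortComplex.mk i p w).ShortExact}
    {x : Ext.{max u v} A B (n + 1)}
    {α : ShiftedHom (t.heart.ι.obj A) (t.heart.ι.obj B) ((n + 1 : ℕ) : ℤ)}
    (h : F.Rep hS x α) : F.Succ x α := by
  have : Epi p := hS.epi_g
  have := h.of_epi F (𝟙 A) p (𝟙 X) (by simp)
  rw [Ext.mk₀_id_comp, CategoryTheory.Functor.map_id, Category.id_comp] at this
  exact ⟨X, p, ‹_›, this⟩

lemma GraphMap.Succ.precomp {A B : t.heart.FullSubcategory} {x : Ext.{max u v} A B (n + 1)}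
    {α : ShiftedHom (t.heart.ι.obj A) (t.heart.ι.obj B) ((n + 1 : ℕ) : ℤ)}
    (h : F.Succ x α) {A' : t.heart.FullSubcategory} (g : A' ⟶ A) :
    F.Succ ((Ext.mk₀ g).comp x (zero_add (n + 1))) (t.heart.ι.map g ≫ α) := by
  obtain ⟨P, p, _, h⟩ := h
  exact ⟨_, pullback.snd p g, inferInstance,
    h.of_epi F g (pullback.snd p g) (pullback.fst p g) pullback.condition⟩

lemma GraphMap.Succ.add {A B : t.heart.FullSubcategory} {x₁ x₂ : Ext.{max u v} A B (n + 1)}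
    {α₁ α₂ : ShiftedHom (t.heart.ι.obj A) (t.heart.ι.obj B) ((n + 1 : ℕ) : ℤ)}
    (h₁ : F.Succ x₁ α₁) (h₂ : F.Succ x₂ α₂) : F.Succ (x₁ + x₂) (α₁ + α₂) := by
  obtain ⟨P₁, p₁, _, h₁⟩ := h₁
  obtain ⟨P₂, p₂, _, h₂⟩ := h₂
  have h₁ := h₁.of_epi F (𝟙 A) (pullback.fst p₁ p₂ ≫ p₁) (pullback.fst p₁ p₂) (by simp)
  have h₂ := h₂.of_epi F (𝟙 A) (pullback.fst p₁ p₂ ≫ p₁) (pullback.snd p₁ p₂)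
    (by simp [pullback.condition])
  rw [Ext.mk₀_id_comp, CategoryTheory.Functor.map_id, Category.id_comp] at h₁ h₂
  obtain ⟨y₁, rfl, rfl⟩ := h₁
  obtain ⟨y₂, rfl, rfl⟩ := h₂
  refine ⟨_, pullback.fst p₁ p₂ ≫ p₁, inferInstance, y₁ + y₂, ?_, ?_⟩
  · rw [Ext.comp_add]
  · rw [map_add, ShiftedHom.comp_add]

lemma GraphMap.Succ.neg {A B : t.heart.FullSubcategory} {x : Ext.{max u v} A B (n + 1)}
    {α : ShiftedHom (t.heart.ι.obj A) (t.heart.ι.obj B) ((n + 1 : ℕ) : ℤ)}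
    (h : F.Succ x α) : F.Succ (-x) (-α) := by
  obtain ⟨P, p, _, y, rfl, rfl⟩ := h
  refine ⟨P, p, inferInstance, -y, ?_, ?_⟩
  · rw [Ext.comp_neg]
  · rw [map_neg, ShiftedHom.comp_neg]

lemma GraphMap.Succ.eq_zero {A B : t.heart.FullSubcategory}
    {α : ShiftedHom (t.heart.ι.obj A) (t.heart.ι.obj B) ((n + 1 : ℕ) : ℤ)}
    (h : F.Succ (0 : Ext.{max u v} A B (n + 1)) α) : α = 0 := by
  obtain ⟨P, p, _, h⟩ := h
  exact h.eq_zero F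

lemma GraphMap.Succ.unique {A B : t.heart.FullSubcategory} {x : Ext.{max u v} A B (n + 1)}
    {α₁ α₂ : ShiftedHom (t.heart.ι.obj A) (t.heart.ι.obj B) ((n + 1 : ℕ) : ℤ)}
    (h₁ : F.Succ x α₁) (h₂ : F.Succ x α₂) : α₁ = α₂ := by
  have h := h₁.add F (h₂.neg F)
  rw [add_neg_cancel] at h
  exact add_neg_eq_zero.1 (h.eq_zero F)

lemma GraphMap.exists_succ {A B : t.heart.FullSubcategory} (x : Ext.{max u v} A B (n + 1)) :
    ∃ α, F.Succ x α := by
  obtain ⟨P, p, _, h⟩ := exists_epi_comp_eq_zero x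
  obtain ⟨α, hα⟩ := F.exists_rep_of_epi p x h (shortExact_kernel p)
  exact ⟨α, P, p, ‹_›, hα⟩

lemma GraphMap.succ_iff {A B : t.heart.FullSubcategory} (x : Ext.{max u v} A B (n + 1))
    (α : ShiftedHom (t.heart.ι.obj A) (t.heart.ι.obj B) ((n + 1 : ℕ) : ℤ)) :
    IsComposite (n + 1) x α ↔ F.Succ x α := by
  constructor
  · rintro ⟨K, X, i, p, w, hS, y, β, h, rfl, rfl⟩
    obtain rfl := (F.graph _ _).1 h
    exact GraphMap.Rep.succ (hS := hS) F ⟨y, rfl, rfl⟩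
  · rintro ⟨P, p, _, y, rfl, rfl⟩
    exact ⟨_, P, _, p, _, shortExact_kernel p, y, _, (F.graph _ _).2 rfl, rfl, rfl⟩

lemma GraphMap.nonempty_succ (F : GraphMap t n) : Nonempty (GraphMap t (n + 1)) := by
  choose f hf using fun (A B : t.heart.FullSubcategory) (x : Ext.{max u v} A B (n + 1)) =>
    F.exists_succ x
  refine ⟨⟨fun A B => AddMonoidHom.mk' (f A B) (fun x y => ?_), fun {A' A B} g x => ?_,
    fun {A B} x α => ?_⟩⟩
  · exact (hf A B (x + y)).unique F ((hf A B x).add F (hf A B y))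
  · exact (hf A' B _).unique F ((hf A B x).precomp F g)
  · rw [F.succ_iff]
    exact ⟨fun h => h.unique F (hf A B x), by rintro rfl; exact hf A B x⟩

variable (t) in
lemma GraphMap.nonempty (n : ℕ) : Nonempty (GraphMap t n) := by
  induction n with
  | zero => exact GraphMap.nonempty_zero
  | succ n hn => exact hn.some.nonempty_succ

end Comparison

/-- The canonical map `Extⁿ(A, B) → Hom(A, B[n])`, sending the class of an `n`-extension of
`A` by `B` to the composite of the connecting morphisms of the short exact sequences into which
it splits. -/
noncomputable def extComparison (n : ℕ) (A B : t.heart.FullSubcategory) :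
    Ext.{max u v} A B n →+ ShiftedHom (t.heart.ι.obj A) (t.heart.ι.obj B) (n : ℤ) :=
  (GraphMap.nonempty t n).some.map A B

/-- `extComparison` is the map whose graph is `IsComposite`. -/
lemma isComposite_iff {n : ℕ} {A B : t.heart.FullSubcategory} (x : Ext.{max u v} A B n)
    (α : ShiftedHom (t.heart.ι.obj A) (t.heart.ι.obj B) (n : ℤ)) :
    IsComposite n x α ↔ α = extComparison n A B x :=
  (GraphMap.nonempty t n).some.graph x α

variable (t)

/-- `T` has all the Ext groups of the heart of `t`: the canonical maps
`Extⁿ(A, B) → Hom(A, B[n])` are isomorphisms. -/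
def HasAllExt : Prop :=
  ∀ (n : ℕ) (A B : t.heart.FullSubcategory), Function.Bijective (extComparison n A B)

/-- The embedding `𝒜 ⥤ D^b(𝒜)` of the heart as complexes concentrated in degree `0`. -/
noncomputable def heartToBounded :
    t.heart.FullSubcategory ⥤ DerivedCategory.Bounded t.heart.FullSubcategory :=
  DerivedCategory.TStructure.t.bounded.lift
    (DerivedCategory.singleFunctor t.heart.FullSubcategory 0)
    (fun _ => ⟨⟨0, inferInstance⟩, ⟨0, inferInstance⟩⟩)

/-- A realization functor for the heart `𝒜` of `t`: an exact functor `D^b(𝒜) ⥤ T` whose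
restriction to `𝒜` is the inclusion. -/
structure RealizationFunctor where
  functor : DerivedCategory.Bounded t.heart.FullSubcategory ⥤ T
  commShift : functor.CommShift ℤ
  isTriangulated : functor.IsTriangulated
  iso : heartToBounded t ⋙ functor ≅ t.heart.ι

attribute [instance] RealizationFunctor.commShift RealizationFunctor.isTriangulated

variable (T) in
/-- `T` is realized: for every full triangulated subcategory `S` of `T` and every heart `𝒜` of
a bounded t-structure on `S`, there is a realization functor `D^b(𝒜) ⥤ S`. -/
def IsRealized : Prop :=
  ∀ (P : ObjectProperty T) [P.IsTriangulated] (s : TStructure P.FullSubcategory),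
    IsBounded s → Nonempty (RealizationFunctor s)

end Heart

end HeartRealization

/-!
A realization functor is compatible with composition and, by uniqueness of the connecting
morphism, sends the class of a short exact sequence to its connecting morphism. Hence, after the
identification of `Extⁿ(A, B)` with `Hom(A, B[n])` in `Dᵇ(𝒜)`, the comparison maps are the maps
induced by `real` on `Hom(A, B[n])`. Negative extensions between objects of a heart vanish, so if
the comparison maps are bijective, then `real` is fully faithful on shifts of objects of the heart,
and by dévissage along the t-structure it is fully faithful.

A functor which is t-exact and reflects zero objects of the heart reflects zero objects of the
bounded category, hence isomorphisms. If such a functor is full and kills `f : X ⟶ Y`, with cone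
`g : Y ⟶ Z`, then the image of `g` has a retraction, which lifts to some `r : Z ⟶ Y`. Since
`g ≫ r` is sent to the identity it is an isomorphism, so `g` is a monomorphism and `f = 0`.

The essential image of a full triangulated functor is a triangulated subcategory. That of `real`
contains the heart, hence every object of `𝒯`, the t-structure being bounded.
-/

namespace HeartRealization

section BijectiveOnHom

universe v₁ u₁ v₂ u₂ v₃ u₃

variable {C : Type u₁} [Category.{v₁} C] {D : Type u₂} [Category.{v₂} D]

/-- The property that `F` is bijective on the morphisms from `X` to `Y`: full faithfulness,
tested on a single pair of objects. -/
abbrev BijectiveOnHom (F : C ⥤ D) (X Y : C) : Prop :=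
  Function.Bijective (F.map : (X ⟶ Y) → (F.obj X ⟶ F.obj Y))

lemma bijectiveOnHom_iff_of_natIso {F G : C ⥤ D} (e : F ≅ G) (X Y : C) :
    BijectiveOnHom F X Y ↔ BijectiveOnHom G X Y := by
  have h : G.map = (e.app X).homCongr (e.app Y) ∘ (F.map : (X ⟶ Y) → _) := by
    ext f
    exact (NatIso.naturality_1 e f).symm
  rw [BijectiveOnHom, BijectiveOnHom, h, Equiv.comp_bijective]

lemma bijectiveOnHom_comp_iff_of_left {E : Type u₃} [Category.{v₃} E] (F : C ⥤ D) (G : D ⥤ E)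
    [F.Full] [F.Faithful] (X Y : C) :
    BijectiveOnHom (F ⋙ G) X Y ↔ BijectiveOnHom G (F.obj X) (F.obj Y) :=
  Function.Bijective.of_comp_iff G.map ((Functor.FullyFaithful.ofFullyFaithful F).map_bijective X Y)

lemma bijectiveOnHom_comp_iff_of_right {E : Type u₃} [Category.{v₃} E] (F : C ⥤ D) (G : D ⥤ E)
    [G.Full] [G.Faithful] (X Y : C) :
    BijectiveOnHom (F ⋙ G) X Y ↔ BijectiveOnHom F X Y :=
  Function.Bijective.of_comp_iff' ((Functor.FullyFaithful.ofFullyFaithful G).map_bijective _ _)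
    F.map

variable {F : C ⥤ D}

lemma bijectiveOnHom_iff_of_iso {X X' Y Y' : C} (e : X ≅ X') (e' : Y ≅ Y') :
    BijectiveOnHom F X Y ↔ BijectiveOnHom F X' Y' := by
  have h : F.map ∘ e.homCongr e' = (F.mapIso e).homCongr (F.mapIso e') ∘ F.map :=
    funext (F.map_homCongr e e')
  rw [BijectiveOnHom, BijectiveOnHom, ← Equiv.bijective_comp (e.homCongr e'), h,
    Equiv.comp_bijective]

lemma bijectiveOnHom_op_iff (X Y : Cᵒᵖ) :
    BijectiveOnHom F.op X Y ↔ BijectiveOnHom F Y.unop X.unop :=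
  ((opEquiv (F.op.obj X) (F.op.obj Y)).comp_bijective F.op.map).symm.trans
    ((opEquiv X Y).bijective_comp F.map)

lemma full_and_faithful_iff_bijectiveOnHom :
    F.Full ∧ F.Faithful ↔ ∀ X Y, BijectiveOnHom F X Y :=
  ⟨fun ⟨_, _⟩ _ _ => ⟨F.map_injective, F.map_surjective⟩,
    fun h => ⟨⟨(h _ _).surjective⟩, ⟨fun hfg => (h _ _).injective hfg⟩⟩⟩

variable (F) in
/-- The objects `Y` such that `F` is bijective on the morphisms to `Y` from every object
satisfying `S`. -/
def bijectiveFrom (S : ObjectProperty C) : ObjectProperty C :=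
  fun Y => ∀ X : C, S X → BijectiveOnHom F X Y

variable (F) in
/-- The objects `X` such that `F` is bijective on the morphisms from `X` to every object
satisfying `S`, the dual notion to `bijectiveFrom`. -/
def bijectiveTo (S : ObjectProperty C) : ObjectProperty C :=
  fun X => ∀ Y : C, S Y → BijectiveOnHom F X Y

lemma unop_bijectiveFrom_op (S : ObjectProperty C) :
    (bijectiveFrom F.op S.op).unop = bijectiveTo F S := by
  ext X
  exact ⟨fun h Y hY => (bijectiveOnHom_op_iff (.op Y) (.op X)).1 (h (.op Y) hY),
    fun h Y hY => (bijectiveOnHom_op_iff Y (.op X)).2 (h Y.unop hY)⟩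

instance (S : ObjectProperty C) : (bijectiveFrom F S).IsClosedUnderIsomorphisms where
  of_iso e h _ hX := (bijectiveOnHom_iff_of_iso (.refl _) e).1 (h _ hX)

instance (S : ObjectProperty C) : (bijectiveTo F S).IsClosedUnderIsomorphisms where
  of_iso e h Y hY := (bijectiveOnHom_iff_of_iso e (.refl Y)).1 (h Y hY)

variable [HasShift C ℤ] [HasShift D ℤ] [F.CommShift ℤ]

lemma bijectiveOnHom_shift_iff (X Y : C) (n : ℤ) :
    BijectiveOnHom F (X⟦n⟧) (Y⟦n⟧) ↔ BijectiveOnHom F X Y := by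
  rw [← bijectiveOnHom_comp_iff_of_left (shiftFunctor C n) F,
    bijectiveOnHom_iff_of_natIso (F.commShiftIso n), bijectiveOnHom_comp_iff_of_right]

lemma bijectiveOnHom_shift_left_iff (X Y : C) (n : ℤ) :
    BijectiveOnHom F (X⟦n⟧) Y ↔ BijectiveOnHom F X (Y⟦-n⟧) := by
  rw [← bijectiveOnHom_shift_iff X _ n]
  exact bijectiveOnHom_iff_of_iso (.refl _) ((shiftEquiv C n).counitIso.symm.app Y)

lemma bijectiveOnHom_shift_right_iff (X Y : C) (n : ℤ) :
    BijectiveOnHom F X (Y⟦n⟧) ↔ BijectiveOnHom F (X⟦-n⟧) Y := by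
  rw [bijectiveOnHom_shift_left_iff, neg_neg]

instance (S : ObjectProperty C) [S.IsStableUnderShift ℤ] :
    (bijectiveFrom F S).IsStableUnderShift ℤ where
  isStableUnderShiftBy n :=
    ⟨fun Y hY X hX => (bijectiveOnHom_shift_right_iff X Y n).2 (hY _ (S.le_shift (-n) _ hX))⟩

end BijectiveOnHom

section Triangulated

universe v₁ u₁ v₂ u₂

variable {C : Type u₁} [Category.{v₁} C] [Preadditive C] [HasZeroObject C] [HasShift C ℤ]
  [∀ n : ℤ, (shiftFunctor C n).Additive] [Pretriangulated C]
  {D : Type u₂} [Category.{v₂} D] [Preadditive D] [HasZeroObject D] [HasShift D ℤ]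
  [∀ n : ℤ, (shiftFunctor D n).Additive] [Pretriangulated D]

lemma exact_rightComp {T : Triangle C} (hT : T ∈ distTriang C) (X : C) :
    Function.Exact (Preadditive.rightComp X T.mor₁) (Preadditive.rightComp X T.mor₂) := fun f => by
  refine ⟨fun hf => ?_, ?_⟩
  · obtain ⟨g, rfl⟩ := Triangle.coyoneda_exact₂ T hT f hf
    exact ⟨g, rfl⟩
  · rintro ⟨g, rfl⟩
    change (g ≫ T.mor₁) ≫ T.mor₂ = 0
    rw [Category.assoc, comp_distTriang_mor_zero₁₂ T hT, comp_zero]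

variable (F : C ⥤ D) [F.CommShift ℤ] [F.IsTriangulated]

variable {F} in
lemma bijectiveOnHom_obj₃ {T : Triangle C} (hT : T ∈ distTriang C) {X : C}
    (h₁ : BijectiveOnHom F X T.obj₁) (h₁' : BijectiveOnHom F X (T.obj₁⟦(1 : ℤ)⟧))
    (h₂ : BijectiveOnHom F X T.obj₂) (h₂' : BijectiveOnHom F X (T.obj₂⟦(1 : ℤ)⟧)) :
    BijectiveOnHom F X T.obj₃ := by
  have hT' := rot_of_distTriang _ hT
  have hT'' := rot_of_distTriang _ hT'
  have comm {Y Z : C} (g : Y ⟶ Z) : (Preadditive.rightComp (F.obj X) (F.map g)).comp F.mapAddHom =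
      F.mapAddHom.comp (Preadditive.rightComp X g) := by
    ext f
    exact (F.map_comp f g).symm
  exact AddMonoidHom.bijective_of_surjective_of_bijective_of_bijective_of_injective
    (i₁ := F.mapAddHom) (i₂ := F.mapAddHom) (i₃ := F.mapAddHom) (i₄ := F.mapAddHom)
    (i₅ := F.mapAddHom) _ _ _ _ _ _ _ _
    (comm _) (comm _) (comm _) (comm _)
    (exact_rightComp hT X) (exact_rightComp hT' X) (exact_rightComp hT'' X)
    (exact_rightComp (F.map_distinguished _ hT) _)
    (exact_rightComp (F.map_distinguished _ hT') _)
    (exact_rightComp (F.map_distinguished _ hT'') _) h₁.surjective h₂ h₁' h₂'.injective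

instance (S : ObjectProperty C) [S.IsStableUnderShift ℤ] :
    (bijectiveFrom F S).IsTriangulated :=
  have : (bijectiveFrom F S).IsTriangulatedClosed₃ := .mk' fun _ hT h₁ h₂ X hX =>
    bijectiveOnHom_obj₃ hT (h₁ X hX) ((bijectiveFrom F S).le_shift (1 : ℤ) _ h₁ X hX)
      (h₂ X hX) ((bijectiveFrom F S).le_shift (1 : ℤ) _ h₂ X hX)
  { ObjectProperty.IsTriangulatedClosed₂.of_isTriangulatedClosed₃ with
    exists_zero := ⟨_, isZero_zero C, fun _ _ =>
      ⟨fun _ _ _ => (isZero_zero C).eq_of_tgt _ _,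
        fun _ => ⟨0, (F.map_isZero (isZero_zero C)).eq_of_tgt _ _⟩⟩⟩ }

open Pretriangulated.Opposite in
instance (S : ObjectProperty C) [S.IsStableUnderShift ℤ] : (bijectiveTo F S).IsTriangulated := by
  rw [← unop_bijectiveFrom_op]
  infer_instance

lemma isIso_of_isIso_map (hF : ∀ X : C, IsZero (F.obj X) → IsZero X) {X Y : C} (f : X ⟶ Y)
    (hf : IsIso (F.map f)) : IsIso f := by
  obtain ⟨Z, g, h, hT⟩ := distinguished_cocone_triangle f
  exact (Triangle.isZero₃_iff_isIso₁ _ hT).1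
    (hF Z ((Triangle.isZero₃_iff_isIso₁ _ (F.map_distinguished _ hT)).2 hf))

lemma faithful_of_full [F.Full] (hF : ∀ X : C, IsZero (F.obj X) → IsZero X) : F.Faithful := by
  suffices h : ∀ {X Y : C} (f : X ⟶ Y), F.map f = 0 → f = 0 from
    ⟨fun {X Y f g} hfg => sub_eq_zero.1 (h _ (by rw [F.map_sub, hfg, sub_self]))⟩
  intro X Y f hf
  obtain ⟨Z, g, h, hT⟩ := distinguished_cocone_triangle f
  obtain ⟨r, hr⟩ : ∃ r : Z ⟶ Y, 𝟙 (F.obj Y) = F.map g ≫ F.map r := by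
    obtain ⟨r, hr⟩ := Triangle.yoneda_exact₂ _ (F.map_distinguished _ hT) (𝟙 (F.obj Y))
      ((Category.comp_id _).trans hf)
    obtain ⟨r, rfl⟩ := F.map_surjective (X := Z) r
    exact ⟨r, hr⟩
  have : IsIso (g ≫ r) := isIso_of_isIso_map F hF _ (by
    rw [F.map_comp, ← hr]
    infer_instance)
  have : Mono g := mono_of_mono g r
  exact zero_of_comp_mono g (comp_distTriang_mor_zero₁₂ _ hT)

end Triangulated

section TStructure

universe v₁ u₁ v₂ u₂

variable {C : Type u₁} [Category.{v₁} C] [Preadditive C] [HasZeroObject C] [HasShift C ℤ]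
  [∀ n : ℤ, (shiftFunctor C n).Additive] [Pretriangulated C]

lemma heart_shift_iff (t : TStructure C) (X : C) (n : ℤ) :
    t.heart (X⟦n⟧) ↔ t.IsLE X n ∧ t.IsGE X n := by
  rw [t.mem_heart_iff, t.isLE_shift_iff X n n 0, t.isGE_shift_iff X n n 0]

instance (t : TStructure C) (n : ℤ) : (t.le n).ContainsZero :=
  ⟨⟨_, isZero_zero C, (t.isLE_of_isZero (isZero_zero C) n).le⟩⟩

instance (t : TStructure C) (n : ℤ) : (t.le n).IsTriangulatedClosed₂ :=
  .mk' fun Δ hΔ h₁ h₃ => (t.isLE₂ Δ hΔ n ⟨h₁⟩ ⟨h₃⟩).le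

lemma isZero₃_of_isZero₂ (t : TStructure C) {Δ : Triangle C} (hΔ : Δ ∈ distTriang C)
    (h : IsZero Δ.obj₂) (a b : ℤ) (hab : a ≤ b)
    (h₁ : t.IsLE Δ.obj₁ a) (h₃ : t.IsGE Δ.obj₃ b) :
    IsZero Δ.obj₃ := by
  have : IsIso Δ.mor₃ := (Triangle.isZero₂_iff_isIso₃ _ hΔ).1 h
  have := t.isLE_shift Δ.obj₁ a 1 (a - 1)
  have : t.IsLE Δ.obj₃ (a - 1) := t.isLE_of_iso (asIso Δ.mor₃).symm _
  exact t.isZero Δ.obj₃ (a - 1) b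

lemma prop_of_isGE_of_isLE [IsTriangulated C] (t : TStructure C) (R : ObjectProperty C)
    [R.IsClosedUnderIsomorphisms] [R.ContainsZero] [R.IsTriangulatedClosed₂] {a b : ℤ}
    (hR : ∀ n ≤ b, ∀ X : C, t.IsLE X n → t.IsGE X n → R X) (X : C) [t.IsGE X a] [t.IsLE X b] :
    R X := by
  have key (k : ℕ) : ∀ X : C, t.IsGE X a → t.IsLE X (a - 1 + k) → a - 1 + k ≤ b → R X := by
    induction k with
    | zero =>
      intro X _ _ _
      exact R.prop_of_isZero (t.isZero X (a - 1 + (0 : ℕ)) a)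
    | succ k ih =>
      intro X _ _ hk
      refine R.ext_of_isTriangulatedClosed₂ _
        (t.triangleLEGE_distinguished (a - 1 + k) (a - 1 + (k + 1 : ℕ)) (by lia) X) ?_ ?_
      · exact ih ((t.truncLE _).obj X) inferInstance inferInstance (by lia)
      · exact hR _ hk ((t.truncGE _).obj X) inferInstance inferInstance
  by_cases hab : a ≤ b
  · exact key (b - a + 1).toNat X inferInstance (t.isLE_of_le X b _ (by lia)) (by lia)
  · exact R.prop_of_isZero (t.isZero X b a)

lemma prop_of_heart_le [IsTriangulated C] {t : TStructure C} (R : ObjectProperty C)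
    [R.IsTriangulated] [R.IsClosedUnderIsomorphisms] (hR : t.heart ≤ R) {X : C}
    (hX : t.bounded X) : R X := by
  obtain ⟨⟨a, _⟩, ⟨b, _⟩⟩ := hX
  refine prop_of_isGE_of_isLE t R (a := a) (b := b) (fun n _ Y h₁ h₂ => ?_) X
  exact R.prop_of_iso ((shiftEquiv C n).unitIso.symm.app Y)
    (R.le_shift (-n) _ (hR _ ((heart_shift_iff t Y n).2 ⟨h₁, h₂⟩)))

variable {D : Type u₂} [Category.{v₂} D] [Preadditive D] [HasShift D ℤ]
  [∀ n : ℤ, (shiftFunctor D n).Additive] {F : C ⥤ D} [F.CommShift ℤ]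

lemma isZero_of_isZero_obj_of_isLE_of_isGE {t : TStructure C}
    (hF₀ : ∀ X, t.heart X → IsZero (F.obj X) → IsZero X) {X : C} {n : ℤ} (h₁ : t.IsLE X n)
    (h₂ : t.IsGE X n) (h : IsZero (F.obj X)) : IsZero X :=
  have hX : IsZero (X⟦n⟧) := hF₀ _ ((heart_shift_iff t X n).2 ⟨h₁, h₂⟩)
    (((shiftFunctor D n).map_isZero h).of_iso ((F.commShiftIso n).app X))
  ((shiftFunctor C (-n)).map_isZero hX).of_iso ((shiftEquiv C n).unitIso.app X)

variable [HasZeroObject D] [Pretriangulated D]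

lemma isLE_and_isGE_obj {t : TStructure C} {t' : TStructure D}
    (hF : t.heart ≤ t'.heart.inverseImage F) {X : C} {n : ℤ} (h₁ : t.IsLE X n)
    (h₂ : t.IsGE X n) : t'.IsLE (F.obj X) n ∧ t'.IsGE (F.obj X) n :=
  (heart_shift_iff t' _ n).1 (t'.heart.prop_of_iso ((F.commShiftIso n).app X)
    (hF _ ((heart_shift_iff t X n).2 ⟨h₁, h₂⟩)))

lemma bijectiveOnHom_of_neg {t : TStructure C} {t' : TStructure D}
    (hF : t.heart ≤ t'.heart.inverseImage F) {X Y : C} (hX : t.heart X) (hY : t.heart Y) {n : ℤ}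
    (hn : n < 0) : BijectiveOnHom F X (Y⟦n⟧) := by
  have h (f : X ⟶ Y⟦n⟧) : f = 0 := hom_shift_eq_zero t (X := ⟨X, hX⟩) (Y := ⟨Y, hY⟩) f hn
  have h' (f : F.obj X ⟶ F.obj (Y⟦n⟧)) : f = 0 := by
    rw [← Preadditive.IsIso.comp_right_eq_zero f ((F.commShiftIso n).hom.app Y)]
    exact hom_shift_eq_zero t' (X := ⟨_, hF X hX⟩) (Y := ⟨_, hF Y hY⟩) _ hn
  exact ⟨fun f g _ => (h f).trans (h g).symm, fun f => ⟨0, (h' _).trans (h' f).symm⟩⟩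

variable [F.IsTriangulated]

instance (P : ObjectProperty D) [P.IsClosedUnderIsomorphisms] [P.IsTriangulatedClosed₂] :
    (P.inverseImage F).IsTriangulatedClosed₂ :=
  .mk' fun _ hT h₁ h₃ => P.ext_of_isTriangulatedClosed₂ _ (F.map_distinguished _ hT) h₁ h₃

variable [IsTriangulated C]

lemma bijectiveOnHom_of_heart {t : TStructure C}
    (h : ∀ (X Y : C) (n : ℤ), t.heart X → t.heart Y → BijectiveOnHom F X (Y⟦n⟧)) {X Y : C}
    (hX : t.bounded X) (hY : t.bounded Y) : BijectiveOnHom F X Y := by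
  have hto : t.heart ≤ bijectiveTo F t.bounded := fun A hA Y hY => by
    refine prop_of_heart_le (bijectiveFrom F (t.heart.shiftClosure ℤ)) ?_ hY A
      (t.heart.le_shiftClosure _ hA)
    rintro B hB _ ⟨A', n, e, hA'⟩
    exact (bijectiveOnHom_iff_of_iso e (.refl B)).2
      ((bijectiveOnHom_shift_left_iff A' B n).2 (h A' B (-n) hA' hB))
  exact prop_of_heart_le (bijectiveTo F t.bounded) hto hX Y hY

variable {t : TStructure C} {t' : TStructure D} (hF : t.heart ≤ t'.heart.inverseImage F)
include hF

lemma isLE_obj_of_isGE {a b : ℤ} (X : C) [t.IsGE X a] [t.IsLE X b] : t'.IsLE (F.obj X) b := by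
  refine ⟨prop_of_isGE_of_isLE t ((t'.le b).inverseImage F) (a := a) (b := b)
    (fun n hn Y h₁ h₂ => ?_) X⟩
  have := (isLE_and_isGE_obj hF h₁ h₂).1
  exact (t'.isLE_of_le (F.obj Y) n b hn).le

variable (hF₀ : ∀ X, t.heart X → IsZero (F.obj X) → IsZero X)
include hF₀

lemma isLE_pred_of_isZero_obj {a b : ℤ} {X : C} (h₁ : t.IsGE X a) (h₂ : t.IsLE X b)
    (h : IsZero (F.obj X)) : t.IsLE X (b - 1) := by
  have hT := t.triangleLEGE_distinguished (b - 1) b (by lia) X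
  let L := (t.truncLE (b - 1)).obj X
  let M := (t.truncGE b).obj X
  have hM : t.IsLE M b := inferInstance
  have hM' : t.IsGE M b := inferInstance
  have hFL : t'.IsLE (F.obj L) (b - 1) := isLE_obj_of_isGE hF L (a := a)
  have hFM : t'.IsGE (F.obj M) b := (isLE_and_isGE_obj hF hM hM').2
  have hFM₀ : IsZero (F.obj M) :=
    isZero₃_of_isZero₂ t' (F.map_distinguished _ hT) h (b - 1) b (by lia) hFL hFM
  exact (t.isLE_iff_isZero_truncGE_obj (b - 1) b (by lia) X).2
    (isZero_of_isZero_obj_of_isLE_of_isGE hF₀ hM hM' hFM₀)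

lemma isZero_of_isZero_obj_of_bounded {X : C} (hX : t.bounded X)
    (h : IsZero (F.obj X)) : IsZero X := by
  obtain ⟨⟨a, _⟩, ⟨b, _⟩⟩ := hX
  have key (k : ℕ) : t.IsLE X (b - k) := by
    induction k with
    | zero => simpa
    | succ k ih =>
      have := isLE_pred_of_isZero_obj hF hF₀ ‹_› ih h
      rwa [Nat.cast_succ, ← sub_sub]
  have := key (b - a + 1).toNat
  exact t.isZero X (b - (b - a + 1).toNat) a

end TStructure

section ShiftedHom

universe v₁ u₁ v₂ u₂ v₃ u₃

variable {C : Type u₁} [Category.{v₁} C] {D : Type u₂} [Category.{v₂} D]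
  {A : Type u₃} [Category.{v₃} A] {J : A ⥤ C} {F : C ⥤ D} {I : A ⥤ D} (e : J ⋙ F ≅ I)

section

variable {M : Type*} [AddMonoid M] [HasShift C M] [HasShift D M] [F.CommShift M]

/-- The map `Hom(J X, (J Y)[a]) → Hom(I X, (I Y)[a])` induced by a functor `F` whose restriction
along `J` is identified with `I`. -/
def mapShiftedHom {X Y : A} {a : M} (x : ShiftedHom (J.obj X) (J.obj Y) a) :
    ShiftedHom (I.obj X) (I.obj Y) a :=
  e.inv.app X ≫ x.map F ≫ (e.hom.app Y)⟦a⟧'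

lemma mapShiftedHom_mk₀ {X Y : A} (f : X ⟶ Y) (m₀ : M) (hm₀ : m₀ = 0) :
    mapShiftedHom e (ShiftedHom.mk₀ m₀ hm₀ (J.map f)) = ShiftedHom.mk₀ m₀ hm₀ (I.map f) := by
  rw [mapShiftedHom, ShiftedHom.map_mk₀, ← ShiftedHom.comp_mk₀ _ m₀ hm₀,
    ShiftedHom.mk₀_comp_mk₀, ← ShiftedHom.mk₀_comp m₀ hm₀, ShiftedHom.mk₀_comp_mk₀]
  exact congrArg _ (NatIso.naturality_1 e f)

lemma mapShiftedHom_comp {X Y Z : A} {a b c : M} (x : ShiftedHom (J.obj X) (J.obj Y) a)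
    (y : ShiftedHom (J.obj Y) (J.obj Z) b) (h : b + a = c) :
    mapShiftedHom e (x.comp y h) = (mapShiftedHom e x).comp (mapShiftedHom e y) h := by
  have cancel : (e.hom.app Y)⟦a⟧' ≫ (e.inv.app Y)⟦a⟧' = 𝟙 _ := by
    rw [← Functor.map_comp, Iso.hom_inv_id_app, CategoryTheory.Functor.map_id]
  have hadd := (shiftFunctorAdd' D b a c h).inv.naturality (e.hom.app Z)
  rw [Functor.comp_map] at hadd
  rw [mapShiftedHom, ShiftedHom.map_comp]
  simp only [mapShiftedHom, ShiftedHom.comp, Functor.map_comp, Category.assoc, hadd,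
    reassoc_of% cancel]
  rfl

lemma bijective_shiftedHom_map_iff (F : C ⥤ D) [F.CommShift M] (X Y : C) (a : M) :
    Function.Bijective (fun x : ShiftedHom X Y a => x.map F) ↔ BijectiveOnHom F X (Y⟦a⟧) :=
  ((F.commShiftIso a).app Y).homToEquiv.comp_bijective F.map

lemma bijective_mapShiftedHom_iff (X Y : A) (a : M) :
    Function.Bijective (mapShiftedHom e (X := X) (Y := Y) (a := a)) ↔
      BijectiveOnHom F (J.obj X) ((J.obj Y)⟦a⟧) := by
  rw [← bijective_shiftedHom_map_iff]
  exact ((e.app X).homCongr ((shiftFunctor D a).mapIso (e.app Y))).comp_bijective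
    (fun x : ShiftedHom (J.obj X) (J.obj Y) a => x.map F)

end

variable [Preadditive C] [HasZeroObject C] [HasShift C ℤ] [∀ n : ℤ, (shiftFunctor C n).Additive]
  [Pretriangulated C] [Preadditive D] [HasZeroObject D] [HasShift D ℤ]
  [∀ n : ℤ, (shiftFunctor D n).Additive] [Pretriangulated D] [F.CommShift ℤ] [F.IsTriangulated]

lemma mapShiftedHom_distinguished {X Y Z : A} {f : X ⟶ Y} {g : Y ⟶ Z}
    {d : ShiftedHom (J.obj Z) (J.obj X) (1 : ℤ)}
    (hd : Triangle.mk (J.map f) (J.map g) d ∈ distTriang C) :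
    Triangle.mk (I.map f) (I.map g) (mapShiftedHom e d) ∈ distTriang D := by
  refine isomorphic_distinguished _ (F.map_distinguished _ hd) _
    (Triangle.isoMk _ _ (e.symm.app X) (e.symm.app Y) (e.symm.app Z) (e.inv.naturality f)
      (e.inv.naturality g) ?_)
  have cancel : (e.hom.app X)⟦(1 : ℤ)⟧' ≫ (e.inv.app X)⟦(1 : ℤ)⟧' = 𝟙 _ := by
    rw [← Functor.map_comp, Iso.hom_inv_id_app, CategoryTheory.Functor.map_id]
  change (e.inv.app Z ≫ d.map F ≫ (e.hom.app X)⟦(1 : ℤ)⟧') ≫ (e.inv.app X)⟦(1 : ℤ)⟧' =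
    e.inv.app Z ≫ d.map F
  rw [Category.assoc, Category.assoc, cancel]
  exact congrArg _ (Category.comp_id _)

end ShiftedHom

section BoundedDerivedCategory

universe w₁ w₂ v₁ u₁

variable (C : Type u₁) [Category.{v₁} C] [Abelian C] [HasDerivedCategory.{w₁} C]

/-- The embedding of an abelian category in its bounded derived category, as the complexes
concentrated in degree `0`. -/
noncomputable def boundedSingleFunctor : C ⥤ DerivedCategory.Bounded C :=
  DerivedCategory.TStructure.t.bounded.lift (DerivedCategory.singleFunctor C 0)
    (fun _ => ⟨⟨0, inferInstance⟩, ⟨0, inferInstance⟩⟩)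

lemma bounded_onBounded (X : DerivedCategory.Bounded C) :
    (DerivedCategory.TStructure.t (C := C)).onBounded.bounded X := by
  obtain ⟨X, ⟨a, ha⟩, ⟨b, hb⟩⟩ := X
  exact ⟨⟨a, (ObjectProperty.tStructure_isGE_iff _ _ _ _).2 ha⟩,
    ⟨b, (ObjectProperty.tStructure_isLE_iff _ _ _ _).2 hb⟩⟩

variable {C}

lemma exists_iso_boundedSingleFunctor_obj {X : DerivedCategory.Bounded C}
    (hX : DerivedCategory.TStructure.t.onBounded.heart X) :
    ∃ A : C, Nonempty (X ≅ (boundedSingleFunctor C).obj A) := by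
  obtain ⟨h₁, h₂⟩ := (TStructure.mem_heart_iff _ _).1 hX
  have : X.obj.IsLE 0 := (ObjectProperty.tStructure_isLE_iff _ _ _ _).1 h₁
  have : X.obj.IsGE 0 := (ObjectProperty.tStructure_isGE_iff _ _ _ _).1 h₂
  obtain ⟨A, ⟨e⟩⟩ := DerivedCategory.exists_iso_singleFunctor_obj_of_isGE_of_isLE X.obj 0
  exact ⟨A, ⟨DerivedCategory.TStructure.t.bounded.fullyFaithfulι.preimageIso
    (Y := (boundedSingleFunctor C).obj A) e⟩⟩

variable [HasExt.{w₂} C]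

/-- The bijection between `Extⁿ(A, B)` and `Hom(A, B[n])` in the bounded derived category. -/
noncomputable def boundedExtEquiv (n : ℕ) (A B : C) :
    Ext.{w₂} A B n ≃
      ShiftedHom ((boundedSingleFunctor C).obj A) ((boundedSingleFunctor C).obj B) (n : ℤ) :=
  Ext.homEquiv.trans (Equiv.ofBijective _ ((bijective_shiftedHom_map_iff DerivedCategory.Bounded.ι
    ((boundedSingleFunctor C).obj A) ((boundedSingleFunctor C).obj B) (n : ℤ)).2
      ⟨Functor.map_injective _, Functor.map_surjective _⟩)).symm

lemma boundedExtEquiv_eq_iff {n : ℕ} {A B : C} (x : Ext.{w₂} A B n)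
    (y : ShiftedHom ((boundedSingleFunctor C).obj A) ((boundedSingleFunctor C).obj B) (n : ℤ)) :
    boundedExtEquiv n A B x = y ↔ x.hom = y.map DerivedCategory.Bounded.ι :=
  ((boundedExtEquiv n A B).eq_symm_apply).symm.trans (Equiv.eq_symm_apply Ext.homEquiv)

lemma map_boundedExtEquiv {n : ℕ} {A B : C} (x : Ext.{w₂} A B n) :
    (boundedExtEquiv n A B x).map DerivedCategory.Bounded.ι = x.hom :=
  ((boundedExtEquiv_eq_iff x _).1 rfl).symm

lemma boundedExtEquiv_mk₀ {A B : C} (f : A ⟶ B) :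
    boundedExtEquiv 0 A B (Ext.mk₀ f) =
      ShiftedHom.mk₀ ((0 : ℕ) : ℤ) (by simp) ((boundedSingleFunctor C).map f) := by
  rw [boundedExtEquiv_eq_iff, ShiftedHom.map_mk₀, Ext.mk₀_hom]
  rfl

lemma boundedExtEquiv_comp {X Y Z : C} {a b c : ℕ} (x : Ext.{w₂} X Y a) (y : Ext.{w₂} Y Z b)
    (h : a + b = c) :
    boundedExtEquiv c X Z (x.comp y h) =
      (boundedExtEquiv a X Y x).comp (boundedExtEquiv b Y Z y) (by lia) := by
  rw [boundedExtEquiv_eq_iff, ShiftedHom.map_comp, map_boundedExtEquiv, map_boundedExtEquiv,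
    Ext.comp_hom]
  rfl

lemma boundedExtEquiv_extClass_distinguished {S : ShortComplex C} (hS : S.ShortExact) :
    Triangle.mk ((boundedSingleFunctor C).map S.f) ((boundedSingleFunctor C).map S.g)
      (boundedExtEquiv 1 _ _ hS.extClass) ∈ distTriang (DerivedCategory.Bounded C) := by
  have h : hS.singleTriangle = DerivedCategory.Bounded.ι.mapTriangle.obj
      (Triangle.mk ((boundedSingleFunctor C).map S.f) ((boundedSingleFunctor C).map S.g)
        (boundedExtEquiv 1 _ _ hS.extClass)) :=
    congrArg (Triangle.mk _ _) ((map_boundedExtEquiv _).trans hS.extClass_hom).symm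
  have hS' := hS.singleTriangle_distinguished
  rwa [h] at hS'

end BoundedDerivedCategory

section DerivedFunctor

universe v₁ u₁ w₁ v₂ u₂ w₂

variable {C : Type u₁} [Category.{v₁} C] [Abelian C] [HasDerivedCategory.{w₁} C]
  {D : Type u₂} [Category.{v₂} D] [Abelian D] [HasDerivedCategory.{w₂} D]
  (F : C ⥤ D) [F.Additive] [PreservesFiniteLimits F] [PreservesFiniteColimits F]

lemma bounded_mapDerivedCategory_obj {X : DerivedCategory C}
    (hX : DerivedCategory.TStructure.t.bounded X) :
    DerivedCategory.TStructure.t.bounded (F.mapDerivedCategory.obj X) := by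
  obtain ⟨⟨a, ⟨K, e, hK⟩⟩, ⟨b, ⟨L, e', hL⟩⟩⟩ := hX
  let e₁ := F.mapDerivedCategory.mapIso e ≪≫ F.mapDerivedCategoryFactors.app K
  let e₂ := F.mapDerivedCategory.mapIso e' ≪≫ F.mapDerivedCategoryFactors.app L
  exact ⟨⟨a, ⟨_, e₁, inferInstance⟩⟩, ⟨b, ⟨_, e₂, inferInstance⟩⟩⟩

/-- The functor between bounded derived categories induced by an exact functor. -/
noncomputable def mapBounded : DerivedCategory.Bounded C ⥤ DerivedCategory.Bounded D :=
  DerivedCategory.TStructure.t.bounded.lift (DerivedCategory.Bounded.ι ⋙ F.mapDerivedCategory)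
    (fun X => bounded_mapDerivedCategory_obj F X.property)

noncomputable instance : (mapBounded F).CommShift ℤ := by
  dsimp only [mapBounded]
  infer_instance

instance : (mapBounded F).IsTriangulated := by
  dsimp only [mapBounded]
  infer_instance

/-- The functor induced by an exact functor `F` restricts to `F` on complexes concentrated in
degree `0`. -/
noncomputable def boundedSingleFunctorCompMapBounded :
    boundedSingleFunctor C ⋙ mapBounded F ≅ F ⋙ boundedSingleFunctor D :=
  (DerivedCategory.TStructure.t.bounded.fullyFaithfulι.whiskeringRight _).preimageIso
    (F.mapDerivedCategorySingleFunctor 0)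

end DerivedFunctor

section RealizationFunctor

variable {T : Type u} [Category.{v} T] [Preadditive T] [HasZeroObject T] [HasShift T ℤ]
  [∀ n : ℤ, (shiftFunctor T n).Additive] [Pretriangulated T] [IsTriangulated T]
  {t : TStructure T}

namespace RealizationFunctor

variable (r : RealizationFunctor t)

/-- A realization functor restricts to the inclusion of the heart on complexes concentrated in
degree `0`. -/
abbrev singleIso : boundedSingleFunctor t.heart.FullSubcategory ⋙ r.functor ≅ t.heart.ι :=
  r.iso

lemma mapShiftedHom_extClass {S : ShortComplex t.heart.FullSubcategory} (hS : S.ShortExact) :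
    mapShiftedHom r.singleIso (boundedExtEquiv 1 _ _ hS.extClass) = connecting hS :=
  (existsUnique_connecting hS).unique
    (mapShiftedHom_distinguished r.singleIso (boundedExtEquiv_extClass_distinguished hS))
    (connecting_distinguished hS)

lemma eq_mapShiftedHom_of_isComposite {n : ℕ} {A B : t.heart.FullSubcategory}
    {x : Ext.{max u v} A B n} {α : ShiftedHom (t.heart.ι.obj A) (t.heart.ι.obj B) (n : ℤ)}
    (h : IsComposite n x α) : α = mapShiftedHom r.singleIso (boundedExtEquiv n A B x) := by
  induction n generalizing A B with
  | zero =>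
    obtain ⟨g, rfl, rfl⟩ := h
    rw [boundedExtEquiv_mk₀, mapShiftedHom_mk₀]
  | succ n ih =>
    obtain ⟨K, X, i, p, w, hS, y, β, h, rfl, rfl⟩ := h
    rw [boundedExtEquiv_comp, mapShiftedHom_comp, ← ih h]
    congr 1
    exact (r.mapShiftedHom_extClass hS).symm

lemma extComparison_eq {n : ℕ} {A B : t.heart.FullSubcategory} (x : Ext.{max u v} A B n) :
    extComparison n A B x = mapShiftedHom r.singleIso (boundedExtEquiv n A B x) :=
  r.eq_mapShiftedHom_of_isComposite ((isComposite_iff x _).2 rfl)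

lemma hasAllExt_iff : HasAllExt t ↔ ∀ (n : ℕ) (A B : t.heart.FullSubcategory),
    BijectiveOnHom r.functor ((boundedSingleFunctor _).obj A)
      (((boundedSingleFunctor _).obj B)⟦(n : ℤ)⟧) := by
  refine forall_congr' fun n => forall_congr' fun A => forall_congr' fun B => ?_
  rw [← bijective_mapShiftedHom_iff r.singleIso,
    ← Function.Bijective.of_comp_iff _ (boundedExtEquiv n A B).bijective]
  exact iff_of_eq (congrArg _ (funext r.extComparison_eq))

lemma heart_le_inverseImage_heart :
    DerivedCategory.TStructure.t.onBounded.heart ≤ t.heart.inverseImage r.functor := fun _ hX =>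
  have ⟨A, ⟨e⟩⟩ := exists_iso_boundedSingleFunctor_obj hX
  t.heart.prop_of_iso (r.functor.mapIso e ≪≫ r.singleIso.app A).symm A.property

lemma isZero_of_heart {X : DerivedCategory.Bounded t.heart.FullSubcategory}
    (hX : DerivedCategory.TStructure.t.onBounded.heart X) (h : IsZero (r.functor.obj X)) :
    IsZero X := by
  obtain ⟨A, ⟨e⟩⟩ := exists_iso_boundedSingleFunctor_obj hX
  have hA : IsZero A := IsZero.of_full_of_faithful_of_isZero t.heart.ι A
    (h.of_iso (r.functor.mapIso e ≪≫ r.singleIso.app A).symm)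
  have hA' : IsZero ((boundedSingleFunctor _).obj A) :=
    IsZero.of_full_of_faithful_of_isZero DerivedCategory.Bounded.ι _
      ((DerivedCategory.singleFunctor _ 0).map_isZero hA)
  exact hA'.of_iso e

lemma isZero_of_isZero_functor_obj (X : DerivedCategory.Bounded t.heart.FullSubcategory)
    (h : IsZero (r.functor.obj X)) : IsZero X :=
  isZero_of_isZero_obj_of_bounded r.heart_le_inverseImage_heart (fun _ => r.isZero_of_heart)
    (bounded_onBounded _ X) h

lemma bijectiveOnHom_of_hasAllExt (h : HasAllExt t)
    (X Y : DerivedCategory.Bounded t.heart.FullSubcategory) : BijectiveOnHom r.functor X Y := by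
  refine bijectiveOnHom_of_heart (fun X Y n hX hY => ?_) (bounded_onBounded _ X)
    (bounded_onBounded _ Y)
  by_cases hn : n < 0
  · exact bijectiveOnHom_of_neg r.heart_le_inverseImage_heart hX hY hn
  · lift n to ℕ using not_lt.1 hn
    obtain ⟨A, ⟨e⟩⟩ := exists_iso_boundedSingleFunctor_obj hX
    obtain ⟨B, ⟨e'⟩⟩ := exists_iso_boundedSingleFunctor_obj hY
    exact (bijectiveOnHom_iff_of_iso e ((shiftFunctor _ (n : ℤ)).mapIso e')).2
      (r.hasAllExt_iff.1 h n A B)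

lemma tfae : [HasAllExt t, r.functor.Full ∧ r.functor.Faithful, r.functor.Full].TFAE := by
  tfae_have 1 → 2 := fun h =>
    full_and_faithful_iff_bijectiveOnHom.2 (r.bijectiveOnHom_of_hasAllExt h)
  tfae_have 2 → 1 := fun h => r.hasAllExt_iff.2 fun _ _ _ =>
    full_and_faithful_iff_bijectiveOnHom.1 h _ _
  tfae_have 2 → 3 := And.left
  tfae_have 3 → 2 := fun h => ⟨h, faithful_of_full r.functor r.isZero_of_isZero_functor_obj⟩
  tfae_finish

lemma essSurj_of_full (ht : IsBounded t) [r.functor.Full] : r.functor.EssSurj where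
  mem_essImage Y := prop_of_heart_le r.functor.essImage
    (fun X hX => ⟨(boundedSingleFunctor _).obj ⟨X, hX⟩, ⟨r.singleIso.app ⟨X, hX⟩⟩⟩) (ht Y)

end RealizationFunctor

end RealizationFunctor

section Existence

variable {T : Type u} [Category.{v} T] [Preadditive T] [HasZeroObject T] [HasShift T ℤ]
  [∀ n : ℤ, (shiftFunctor T n).Additive] [Pretriangulated T]

instance : (⊤ : ObjectProperty T).IsTriangulated where
  ext₂' Δ _ _ _ := ⟨Δ.obj₂, trivial, ⟨Iso.refl _⟩⟩

instance (t : TStructure T) : (⊤ : ObjectProperty T).HasInducedTStructure t :=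
  .mk' fun _ _ _ => ⟨trivial, trivial⟩

variable (t : TStructure T)

/-- The t-structure `t`, considered on the full subcategory of all objects. -/
noncomputable abbrev topTStructure : TStructure (⊤ : ObjectProperty T).FullSubcategory :=
  (⊤ : ObjectProperty T).tStructure t

variable {t} in
lemma isBounded_topTStructure (ht : IsBounded t) : IsBounded (topTStructure t) := by
  intro X
  obtain ⟨⟨a, ha⟩, ⟨b, hb⟩⟩ := ht X.obj
  exact ⟨⟨a, (ObjectProperty.tStructure_isGE_iff _ _ _ _).2 ha⟩,
    ⟨b, (ObjectProperty.tStructure_isLE_iff _ _ _ _).2 hb⟩⟩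

/-- The heart of a t-structure is equivalent to the heart of the same t-structure on the full
subcategory of all objects. -/
def heartToTop : t.heart.FullSubcategory ≌ (topTStructure t).heart.FullSubcategory where
  functor := (topTStructure t).heart.lift ((⊤ : ObjectProperty T).lift t.heart.ι fun _ => trivial)
    fun X => X.property
  inverse := t.heart.lift ((topTStructure t).heart.ι ⋙ ObjectProperty.ι _) fun X => X.property
  unitIso := Iso.refl _
  counitIso := Iso.refl _

instance : (heartToTop t).functor.Additive where

variable [IsTriangulated T] {t}

/-- A realization functor for a t-structure on the full subcategory of all objects induces
one on the category itself. -/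
noncomputable def RealizationFunctor.ofTop (r : RealizationFunctor (topTStructure t)) :
    RealizationFunctor t where
  functor := mapBounded (heartToTop t).functor ⋙ r.functor ⋙ (⊤ : ObjectProperty T).ι
  commShift := inferInstance
  isTriangulated := inferInstance
  iso := Functor.isoWhiskerRight (boundedSingleFunctorCompMapBounded (heartToTop t).functor)
      (r.functor ⋙ (⊤ : ObjectProperty T).ι) ≪≫
    Functor.isoWhiskerLeft (heartToTop t).functor
      (Functor.isoWhiskerRight r.iso (⊤ : ObjectProperty T).ι)

lemma IsRealized.nonempty_realizationFunctor (hT : IsRealized T) (ht : IsBounded t) :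
    Nonempty (RealizationFunctor t) :=
  (hT ⊤ (topTStructure t) (isBounded_topTStructure ht)).map RealizationFunctor.ofTop

end Existence

end HeartRealization

theorem mainTheorem8 {T : Type u} [Category.{v} T] [Preadditive T] [HasZeroObject T] [HasShift T ℤ]
    [∀ n : ℤ, (shiftFunctor T n).Additive] [Pretriangulated T] [IsTriangulated T]
    (hT : HeartRealization.IsRealized T) (t : TStructure T) (ht : HeartRealization.IsBounded t) :
    Nonempty (HeartRealization.RealizationFunctor t) ∧
    ∀ real : HeartRealization.RealizationFunctor t,
      [HeartRealization.HasAllExt t,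
        real.functor.Full ∧ real.functor.Faithful,
        real.functor.Full].TFAE ∧
      (HeartRealization.HasAllExt t →
        real.functor.IsTriangulated ∧ real.functor.IsEquivalence) := by
  refine ⟨hT.nonempty_realizationFunctor ht, fun real => ⟨real.tfae, fun h => ?_⟩⟩
  obtain ⟨_, _⟩ := (real.tfae.out 0 1).1 h
  have := real.essSurj_of_full ht
  exact ⟨real.isTriangulated, {}⟩
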